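/- Throughout, a (finite abstract) simplicial complex $K$ on a finite vertex set $N$ is a family of subsets of $N$, called faces, that is closed under taking subsets; $\dim A=|A|-1$ for a face $A$, $\dim K$ is the maximum dimension of a face of $K$, and $K[U]=\{A\in K: A\subseteq U\}$ for $U\subseteq N$. A complex $K'$ arises from $K$ by an elementary $d$-collapse if there are faces $L,M\in K$ such that $\dim L\le d-1$, $M$ is the unique inclusion-wise maximal face containing $L$, and $K'=K\setminus\{A\in K: L\subseteq A\}$. The complex $K$ is $d$-collapsible if the empty complex can be reached from $K$ by finitely many elementary $d$-collapses, and $d$-representable if it is the nerve of a finite family $(F_v)_{v\in N}$ of convex sets in $\mathbb R^d$ (repetitions allowed), that is, $A\in K$ if and only if $\bigcap_{v\in A}F_v\neq\emptyset$. If $N=N_1\sqcup\dots\sqcup N_c$ and $\mathbf k=(k_1,\dots,k_c)\in\mathbb N_0^c$, let $\binom{N}{\mathbf k}$ be the set of all $A\subseteq N$ with $|A\cap N_i|=k_i$ for all $i$. A face of $K$ is $\mathbf k$-colorful if it belongs to $\binom{N}{\mathbf k}$. For $\boldsymbol\beta=(\beta_1,\dots,\beta_c)\in(0,1]^c$ put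 $$\alpha_{\mathbf k}(d,\boldsymbol\beta)=\sum_{\boldsymbol\ell}\ \prod_{i=1}^{c}\binom{k_i}{\ell_i}(1-\beta_i)^{\ell_i}\beta_i^{\,k_i-\ell_i},$$ where the sum is over all $\boldsymbol\ell=(\ell_1,\dots,\ell_c)\in\mathbb N_0^c$ with $\ell_i\le k_i$ for all $i$ and $\ell_1+\dots+\ell_c\le d$ (and $0^0=1$). **Theorem.** Let $c,d\ge 1$, let $\mathbf k\in\mathbb N_0^c$ with $k_1+\dots+k_c\ge d+1$, and let $\boldsymbol\beta\in(0,1]^c$. (a) Let $K$ be a $d$-collapsible simplicial complex with vertex set $N=N_1\sqcup\dots\sqcup N_c$, let $n_i=|N_i|$, and assume $k_i\le n_i$ for all $i$. If $K$ has at least $\alpha_{\mathbf k}(d,\boldsymbol\beta)\,\bigl|\binom{N}{\mathbf k}\bigr|$ $\mathbf k$-colorful faces, then $\dim K[N_i]\ge\beta_i n_i-1$ for some $i\in\{1,\dots,c\}$. (b) The value $\alpha_{\mathbf k}(d,\boldsymbol\beta)$ cannot be improved: for every real $\alpha'<\alpha_{\mathbf k}(d,\boldsymbol\beta)$ there are a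 finite set $N=N_1\sqcup\dots\sqcup N_c$ with $k_i\le n_i:=|N_i|$ for all $i$ and a simplicial complex $K$ on $N$ that is $d$-representable and $d$-collapsible, in which every $\{v\}$, $v\in N$, is a face, such that $K$ has at least $\alpha'\,\bigl|\binom{N}{\mathbf k}\bigr|$ $\mathbf k$-colorful faces but $\dim K[N_i]<\beta_i n_i-1$ for every $i\in\{1,\dots,c\}$. -/

import Mathlib

open Finset

namespace ColorfulHelly

/-- A finite abstract simplicial complex on the vertex set `N`: a family of finite subsets
of `N` closed under taking subsets. The empty set counts as a face (of dimension `-1`), points of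
`N` need not be faces, and the complex `⊥` without any face is allowed. -/
abbrev SComplex (N : Type*) := LowerSet (Finset N)

section Complexes

variable {N : Type*}

/-- The dimension `|A| - 1` of a face. -/
def faceDim (A : Finset N) : ℤ := (A.card : ℤ) - 1

/-- The induced subcomplex `K[U]`, consisting of the faces of `K` contained in `U`. -/
def induced (K : SComplex N) (U : Finset N) : SComplex N where
  carrier := {A | A ∈ K ∧ A ⊆ U}
  lower' := fun _ _ hBA hA => ⟨K.lower hBA hA.1, hBA.trans hA.2⟩

open Classical in
/-- The dimension of a complex: the largest dimension of a face (a largest cardinality, minus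
one). The complex without any face gets dimension `-1`. -/
noncomputable def dim [Fintype N] (K : SComplex N) : ℤ :=
  (((univ.filter fun A : Finset N => A ∈ K).sup Finset.card : ℕ) : ℤ) - 1

/-- `K'` arises from `K` by an elementary `d`-collapse. -/
def ElementaryCollapse (d : ℕ) (K K' : SComplex N) : Prop :=
  ∃ L ∈ K, ∃ M ∈ K,
    faceDim L ≤ (d : ℤ) - 1 ∧
    (∀ A : Finset N, Maximal (fun B : Finset N => B ∈ K ∧ L ⊆ B) A ↔ A = M) ∧
    ∀ A : Finset N, A ∈ K' ↔ A ∈ K ∧ ¬ L ⊆ A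

/-- `K` is `d`-collapsible: finitely many elementary `d`-collapses lead to the empty complex. -/
def Collapsible (d : ℕ) (K : SComplex N) : Prop :=
  Relation.ReflTransGen (ElementaryCollapse d) K ⊥

/-- `K` is `d`-representable: it is the nerve of a family, indexed by the vertices (so that
repetitions are allowed), of convex sets in `ℝ^d`. -/
def Representable (d : ℕ) (K : SComplex N) : Prop :=
  ∃ F : N → Set (EuclideanSpace ℝ (Fin d)),
    (∀ v, Convex ℝ (F v)) ∧ ∀ A : Finset N, A ∈ K ↔ (⋂ v ∈ A, F v).Nonempty

end Complexes

section Colors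

variable {N : Type*} [Fintype N] {c : ℕ}

/-- The part `N_i` of the partition of `N` given by a coloring `color : N → [c]`. -/
def colorClass (color : N → Fin c) (i : Fin c) : Finset N :=
  univ.filter fun v => color v = i

/-- `binom(N, k)`: the subsets of `N` having exactly `k_i` elements of each color `i`. -/
def colorfulSets (color : N → Fin c) (k : Fin c → ℕ) : Finset (Finset N) :=
  univ.filter fun A => ∀ i, (A.filter fun v => color v = i).card = k i

open Classical in
/-- The `k`-colorful faces of `K`. -/
noncomputable def colorfulFaces (K : SComplex N) (color : N → Fin c) (k : Fin c → ℕ) :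
    Finset (Finset N) :=
  (colorfulSets color k).filter fun A => A ∈ K

end Colors

/-- `L_k(d)`: the vectors `ℓ ≤ k` of non-negative integers with coordinate sum at most `d`. -/
def indexSet {c : ℕ} (k : Fin c → ℕ) (d : ℕ) : Finset (Fin c → ℕ) :=
  (Finset.Iic k).filter fun l => ∑ i, l i ≤ d

/-- `α_k(d, β)`. -/
noncomputable def alpha {c : ℕ} (k : Fin c → ℕ) (d : ℕ) (β : Fin c → ℝ) : ℝ :=
  ∑ l ∈ indexSet k d,
    ∏ i, ((k i).choose (l i) : ℝ) * (1 - β i) ^ (l i) * (β i) ^ (k i - l i)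

end ColorfulHelly

/-! For (a), let r_i be the largest number of vertices in a face of K[N_i], and suppose that r_i <
β_i n_i for every i. Replace colorful sets by tuples with k_i entries of color i, repetitions
allowed, and count those whose entries form a face. With vertices identified with distinct reals,
functions on tuples become polynomials in k_1 + ... + k_c variables. The monomials with each
exponent below the n_i of its color, and at most d exponents reaching their r_i, span all functions
on the face tuples (`exists_mem_monomialSpan_eqOn`). Indeed, a collapse removes the faces between
some L and M, and a removed tuple is isolated by a product of Lagrange polynomials: the nodes are a
full color class at the at most d positions carrying L, and only the vertices of M of the right
color elsewhere.

Hence there are at most as many face tuples as such monomials. Their share among all exponent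
vectors is the probability that at most d of certain independent events happen, with probabilities 1
- r_i/n_i, and this is strictly below α (`atMost_lt_atMost`). Returning to sets costs nothing, since
repetitions only make it easier to be a face (`card_colorfulFaces_mul_prod_le`).

For (b), give each color n vertices: slightly fewer than β_i n copies of the whole space, the rest
hyperplanes, all hyperplanes in general position. A set is a face iff it contains at most d
hyperplanes, so the proportion of colorful faces is a sum of products of hypergeometric
probabilities. These tend to the binomial ones that make up α. -/

namespace ColorfulHelly

/-! ### Probabilities of independent events and counts of exponent vectors -/

section Sums

/-- Expansion of a sum over functions according to the set of coordinates at which a predicate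
holds. -/
theorem sum_mul_prod_eq_sum_finset {P : Type*} [Fintype P] [DecidableEq P] {κ : P → Type*}
    [∀ p, Fintype (κ p)] (w : ∀ p, κ p → ℝ) (b : ∀ p, κ p → Prop)
    [∀ p, DecidablePred (b p)] (φ : Finset P → ℝ) :
    ∑ f : ∀ p, κ p, φ (univ.filter fun p => b p (f p)) * ∏ p, w p (f p) =
      ∑ B : Finset P, φ B * ∏ p, if p ∈ B then ∑ x with b p x, w p x
        else ∑ x with ¬ b p x, w p x := by
  classical
  rw [← Finset.sum_fiberwise (s := univ) (g := fun f : ∀ p, κ p => univ.filter fun p => b p (f p))]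
  refine Finset.sum_congr rfl fun B _ => ?_
  have h1 : (∏ p, if p ∈ B then ∑ x with b p x, w p x else ∑ x with ¬ b p x, w p x) =
      ∏ p, ∑ x ∈ univ.filter (fun x => b p x ↔ p ∈ B), w p x := by
    refine Finset.prod_congr rfl fun p _ => ?_
    split_ifs with h <;> simp [h]
  rw [h1, Finset.prod_univ_sum, Finset.mul_sum]
  have h2 : (univ.filter fun f : ∀ p, κ p => (univ.filter fun p => b p (f p)) = B) =
      Fintype.piFinset fun p => univ.filter (fun x => b p x ↔ p ∈ B) := by
    ext f
    simp [Finset.ext_iff]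
  rw [← h2]
  refine Finset.sum_congr rfl fun f hf => ?_
  rw [(Finset.mem_filter.1 hf).2]

/-- The probability that at most `d` of the independent events indexed by `P` happen, where the
event `p` has probability `1 - x p`. -/
noncomputable def atMost {P : Type*} [Fintype P] [DecidableEq P] (d : ℕ) (x : P → ℝ) : ℝ :=
  ∑ B : Finset P, (if B.card ≤ d then 1 else 0) * ∏ p, if p ∈ B then 1 - x p else x p

/-- Coupling: three-valued variables with weights x, y - x, 1 - y realise both families of events at
once, as "not 0" and as "equal to 2". The second event implies the first. Strictness comes from the
constant outcome 1, which has positive weight: there all events of the first family happen, more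
than d of them, and none of the second. -/
theorem atMost_lt_atMost {P : Type*} [Fintype P] [DecidableEq P] {d : ℕ}
    (hd : d < Fintype.card P) {x y : P → ℝ} (hx : ∀ p, 0 ≤ x p) (hxy : ∀ p, x p < y p)
    (hy : ∀ p, y p ≤ 1) : atMost d x < atMost d y := by
  let w : P → Fin 3 → ℝ := fun p => ![x p, y p - x p, 1 - y p]
  have hw : ∀ p j, 0 ≤ w p j := by
    intro p j
    have := hx p; have := hxy p; have := hy p
    fin_cases j <;> simp [w] <;> linarith
  have ex : atMost d x = ∑ f : P → Fin 3,
      (if (univ.filter fun p => f p ≠ 0).card ≤ d then 1 else 0) * ∏ p, w p (f p) := by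
    rw [sum_mul_prod_eq_sum_finset w (fun _ j => j ≠ 0) (fun B => if B.card ≤ d then 1 else 0)]
    refine Finset.sum_congr rfl fun B _ => congrArg _ (Finset.prod_congr rfl fun p _ => ?_)
    simp [w, Finset.sum_filter, Fin.sum_univ_three]
  have ey : atMost d y = ∑ f : P → Fin 3,
      (if (univ.filter fun p => f p = 2).card ≤ d then 1 else 0) * ∏ p, w p (f p) := by
    rw [sum_mul_prod_eq_sum_finset w (fun _ j => j = 2) (fun B => if B.card ≤ d then 1 else 0)]
    refine Finset.sum_congr rfl fun B _ => congrArg _ (Finset.prod_congr rfl fun p _ => ?_)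
    simp [w, Finset.sum_filter, Fin.sum_univ_three]
  rw [ex, ey]
  refine Finset.sum_lt_sum (fun f _ => ?_) ⟨fun _ => 1, mem_univ _, ?_⟩
  · refine mul_le_mul_of_nonneg_right ?_ (Finset.prod_nonneg fun p _ => hw p _)
    have : (univ.filter fun p => f p = 2).card ≤ (univ.filter fun p => f p ≠ 0).card :=
      Finset.card_le_card fun p => by
        simp only [mem_filter, mem_univ, true_and]
        intro h; rw [h]; decide
    split_ifs <;> first | omega | norm_num
  · have h0 : 0 < ∏ p, w p 1 := Finset.prod_pos fun p _ => by
      have := hxy p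
      simp [w]; linarith
    simpa [Finset.card_univ, not_le.2 hd] using h0

/-- A finite set of dependent pairs is a family of finite sets. -/
def finsetSigmaEquiv {ι : Type*} [Fintype ι] [DecidableEq ι] (X : ι → Type*) [∀ i, Fintype (X i)]
    [∀ i, DecidableEq (X i)] : Finset (Σ i, X i) ≃ ∀ i, Finset (X i) where
  toFun A i := univ.filter fun x => (⟨i, x⟩ : Σ i, X i) ∈ A
  invFun s := univ.sigma s
  left_inv A := by ext ⟨i, x⟩; simp
  right_inv s := by ext i x; simp

/-- Grouping the sets of events by their numbers `l i` of elements in each color produces the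
binomial coefficients. -/
theorem alpha_eq_atMost {c : ℕ} (k : Fin c → ℕ) (d : ℕ) (β : Fin c → ℝ) :
    alpha k d β = atMost d (fun p : Σ i, Fin (k i) => β p.1) := by
  unfold atMost
  rw [← (finsetSigmaEquiv fun i => Fin (k i)).symm.sum_comp]
  have h1 : ∀ s : ∀ i, Finset (Fin (k i)),
      ((if ((finsetSigmaEquiv fun i => Fin (k i)).symm s).card ≤ d then (1 : ℝ) else 0) *
        ∏ p : Σ i, Fin (k i), if p ∈ (finsetSigmaEquiv fun i => Fin (k i)).symm s
          then 1 - β p.1 else β p.1) =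
      if ∑ i, (s i).card ≤ d then
        ∏ i, (1 - β i) ^ (s i).card * (β i) ^ (k i - (s i).card) else 0 := by
    intro s
    have : (∏ p : Σ i, Fin (k i), if p ∈ (finsetSigmaEquiv fun i => Fin (k i)).symm s
          then 1 - β p.1 else β p.1) =
        ∏ i, (1 - β i) ^ (s i).card * (β i) ^ (k i - (s i).card) := by
      rw [Fintype.prod_sigma]
      refine Finset.prod_congr rfl fun i _ => ?_
      have h : (∏ x : Fin (k i), if x ∈ s i then 1 - β i else β i) =
          (1 - β i) ^ (s i).card * (β i) ^ (k i - (s i).card) := by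
        rw [Finset.prod_ite, Finset.prod_const, Finset.prod_const, Finset.filter_not,
          Finset.filter_univ_mem, ← Finset.compl_eq_univ_sdiff, Finset.card_compl,
          Fintype.card_fin]
      refine (Finset.prod_congr rfl fun x _ => ?_).trans h
      simp [finsetSigmaEquiv]
    rw [this]
    simp [finsetSigmaEquiv, Finset.card_sigma]
  rw [Finset.sum_congr rfl fun s _ => h1 s, ← Finset.sum_filter,
    ← Finset.sum_fiberwise_of_maps_to (t := indexSet k d) (g := fun s i => (s i).card)]
  · refine Finset.sum_congr rfl fun l hl => ?_
    simp only [indexSet, mem_filter, mem_Iic] at hl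
    have h2 : ((univ.filter fun s : ∀ i, Finset (Fin (k i)) => ∑ i, (s i).card ≤ d).filter
        fun s => (fun i => (s i).card) = l) =
        Fintype.piFinset fun i => powersetCard (l i) univ := by
      ext s
      simp only [mem_filter, mem_univ, true_and, Fintype.mem_piFinset, mem_powersetCard,
        subset_univ, funext_iff]
      refine ⟨fun h => h.2, fun h => ⟨?_, h⟩⟩
      simpa [h] using hl.2
    rw [h2, Finset.sum_congr rfl (g := fun _ => ∏ i, (1 - β i) ^ l i * (β i) ^ (k i - l i))]
    · simp [Finset.prod_mul_distrib, mul_assoc]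
    · intro s hs
      simp only [Fintype.mem_piFinset, mem_powersetCard, subset_univ, true_and] at hs
      simp [hs]
  · intro s hs
    simp only [mem_filter, mem_univ, true_and] at hs
    simp only [indexSet, mem_filter, mem_Iic]
    exact ⟨fun i => by simpa using Finset.card_le_univ (s i), hs⟩

/-- The number of integer vectors `0 ≤ j < n` that have at most `d` coordinates with `r ≤ j`. -/
theorem card_filter_card_le {P : Type*} [Fintype P] [DecidableEq P] (d : ℕ) (n r : P → ℕ)
    (hn : ∀ p, 0 < n p) (hr : ∀ p, r p ≤ n p) :
    ((univ.filter fun j : ∀ p, Fin (n p) =>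
        (univ.filter fun p => r p ≤ (j p : ℕ)).card ≤ d).card : ℝ) =
      atMost d (fun p => (r p : ℝ) / n p) * ∏ p, (n p : ℝ) := by
  have h := sum_mul_prod_eq_sum_finset (κ := fun p => Fin (n p)) (fun _ _ => (1 : ℝ))
    (fun p j => r p ≤ (j : ℕ)) (fun B => if B.card ≤ d then (1 : ℝ) else 0)
  simp only [Finset.prod_const_one, mul_one, Finset.sum_boole, Finset.sum_const, nsmul_eq_mul]
    at h
  rw [h, atMost, Finset.sum_mul]
  refine Finset.sum_congr rfl fun B _ => ?_
  rw [mul_assoc, ← Finset.prod_mul_distrib]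
  refine congrArg _ (Finset.prod_congr rfl fun p _ => ?_)
  have hlt : (univ.filter fun j : Fin (n p) => ¬ r p ≤ (j : ℕ)).card = r p := by
    simp only [not_le]
    simpa using Fin.card_filter_val_lt (n := n p) (m := r p) |>.trans (min_eq_right (hr p))
  have hge : ((univ.filter fun j : Fin (n p) => r p ≤ (j : ℕ)).card : ℝ) = n p - r p := by
    have := Finset.card_filter_add_card_filter_not (s := (univ : Finset (Fin (n p))))
      (fun j : Fin (n p) => r p ≤ (j : ℕ))
    rw [hlt, Finset.card_univ, Fintype.card_fin] at this
    exact eq_sub_of_add_eq (by exact_mod_cast this)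
  have h0 : (n p : ℝ) ≠ 0 := by exact_mod_cast (hn p).ne'
  rw [hlt, hge]
  split_ifs <;> field_simp

end Sums
-- The polynomial method: bounding the number of face tuples
section Tuples

open Polynomial

variable {N : Type*} {P : Type*} [Fintype P] [DecidableEq P]

/-- The span of the monomials in the coordinates `x (a p)` of a tuple `a` whose exponents are
smaller than `n`, and smaller than `r` with at most `d` exceptions. -/
def monomialSpan (x : N → ℝ) (n r : P → ℕ) (d : ℕ) : Submodule ℝ ((P → N) → ℝ) :=
  Submodule.span ℝ (Set.range fun j : {j : ∀ p, Fin (n p) //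
    j ∈ univ.filter fun j : ∀ p, Fin (n p) =>
      (univ.filter fun p => r p ≤ (j p : ℕ)).card ≤ d} => fun a => ∏ p, x (a p) ^ (j.1 p : ℕ))

/-- When the product is expanded, a monomial with more than d large exponents has one of them at a
position outside `Q`, where the degree bound makes its coefficient zero. -/
theorem prod_eval_mem_monomialSpan (x : N → ℝ) {n r : P → ℕ} {d : ℕ} (q : P → ℝ[X])
    {Q : Finset P} (hQ : Q.card ≤ d) (hn : ∀ p, (q p).natDegree < n p)
    (hr : ∀ p ∉ Q, (q p).natDegree < r p) :
    (fun a : P → N => ∏ p, (q p).eval (x (a p))) ∈ monomialSpan x n r d := by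
  have h1 : (fun a : P → N => ∏ p, (q p).eval (x (a p))) =
      ∑ j : ∀ p, Fin (n p), (∏ p, (q p).coeff (j p)) •
        fun a : P → N => ∏ p, x (a p) ^ (j p : ℕ) := by
    ext a
    simp only [Finset.sum_apply, Pi.smul_apply, smul_eq_mul, ← Finset.prod_mul_distrib]
    rw [← Fintype.piFinset_univ, ← Finset.prod_univ_sum (fun p => (univ : Finset (Fin (n p))))
      fun p (m : Fin (n p)) => (q p).coeff m * x (a p) ^ (m : ℕ)]
    refine Finset.prod_congr rfl fun p _ => ?_
    rw [Polynomial.eval_eq_sum_range' (hn p), Finset.sum_range]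
  rw [h1]
  refine Submodule.sum_mem _ fun j _ => ?_
  by_cases hj : (univ.filter fun p => r p ≤ (j p : ℕ)).card ≤ d
  · exact Submodule.smul_mem _ _ (Submodule.subset_span ⟨⟨j, by simpa using hj⟩, rfl⟩)
  · have : ∃ p ∉ Q, r p ≤ (j p : ℕ) := by
      by_contra! hcon
      refine hj ((Finset.card_le_card fun p hp => ?_).trans hQ)
      by_contra hpQ
      exact absurd (hcon p hpQ) (not_lt.2 (by simpa using hp))
    obtain ⟨p, hpQ, hp⟩ := this
    rw [Finset.prod_eq_zero (mem_univ p)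
      (Polynomial.coeff_eq_zero_of_natDegree_lt ((hr p hpQ).trans_le hp)), zero_smul]
    exact Submodule.zero_mem _

variable [Fintype N] {c : ℕ} (color : N → Fin c) (col : P → Fin c)

open Classical in
/-- The tuples with prescribed colors whose entries form a face. -/
noncomputable def faceTuples (K : SComplex N) : Finset (P → N) :=
  univ.filter fun a => (∀ p, color (a p) = col p) ∧ univ.image a ∈ K

variable {color col}

theorem mem_faceTuples [DecidableEq N] {K : SComplex N} {a : P → N} :
    a ∈ faceTuples color col K ↔ (∀ p, color (a p) = col p) ∧ univ.image a ∈ K := by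
  simp only [faceTuples, mem_filter, mem_univ, true_and]
  refine and_congr_right fun _ => ?_
  convert Iff.rfl

/-- Every face containing `L` lies in the unique maximal one. -/
theorem subset_of_unique_maximal {K : SComplex N} {L M : Finset N}
    (hM : ∀ A : Finset N, Maximal (fun B : Finset N => B ∈ K ∧ L ⊆ B) A ↔ A = M)
    {A : Finset N} (hA : A ∈ K) (hLA : L ⊆ A) : A ⊆ M := by
  obtain ⟨B, hAB, hB⟩ := (Set.toFinite {B : Finset N | B ∈ K ∧ L ⊆ B}).exists_le_maximal
    (show A ∈ {B : Finset N | B ∈ K ∧ L ⊆ B} from ⟨hA, hLA⟩)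
  exact (hM B).1 hB ▸ hAB

/-- A function in the span that is the indicator of a given tuple containing `L`, when restricted
to the face tuples of `K` that lie in `M` or do not contain `L`. -/
theorem exists_isolating_mem_monomialSpan [DecidableEq N] {x : N → ℝ}
    (hx : Function.Injective x) {d : ℕ} {r : Fin c → ℕ} {L M : Finset N} (hL : L.card ≤ d)
    (hM : ∀ i, (M.filter fun v => color v = i).card ≤ r i) {a₀ : P → N}
    (ha₀ : ∀ p, color (a₀ p) = col p) (hLa : L ⊆ univ.image a₀) (haM : univ.image a₀ ⊆ M) :
    ∃ g ∈ monomialSpan x (fun p => (colorClass color (col p)).card) (fun p => r (col p)) d,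
      ∀ a : P → N, (∀ p, color (a p) = col p) → (L ⊆ univ.image a → univ.image a ⊆ M) →
        g a = if a = a₀ then 1 else 0 := by
  have hpre : ∀ v : L, ∃ p, a₀ p = v := fun v => by simpa using hLa v.2
  choose pos hpos using hpre
  let Q : Finset P := univ.image pos
  have hQ : Q.card ≤ d := Finset.card_image_le.trans (by simpa using hL)
  -- Interpolation nodes: `Q` holds one position for each vertex of L, hence at most d positions may
  -- use the full color class; all others keep the degree below r.
  let S : P → Finset N := fun p =>
    if p ∈ Q then colorClass color (col p) else M.filter fun v => color v = col p
  have hS : ∀ p, a₀ p ∈ S p := fun p => by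
    have : a₀ p ∈ M := haM (mem_image_of_mem _ (mem_univ p))
    by_cases h : p ∈ Q <;> simp [S, h, colorClass, ha₀, this]
  have hSsub : ∀ p, S p ⊆ colorClass color (col p) := fun p v => by
    by_cases h : p ∈ Q <;> simp +contextual [S, h, colorClass]
  have hdeg : ∀ p, (Lagrange.basis (S p) x (a₀ p)).natDegree < (S p).card := fun p => by
    rw [Lagrange.natDegree_basis hx.injOn (hS p)]
    exact Nat.sub_lt (Finset.card_pos.2 ⟨_, hS p⟩) one_pos
  refine ⟨_, prod_eval_mem_monomialSpan x (fun p => Lagrange.basis (S p) x (a₀ p)) hQ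
    (fun p => (hdeg p).trans_le (Finset.card_le_card (hSsub p))) (fun p hp => ?_), ?_⟩
  · refine (hdeg p).trans_le ?_
    simpa [S, hp] using hM (col p)
  · intro a ha haLM
    split_ifs with h
    · subst h
      exact Finset.prod_eq_one fun p _ => Lagrange.eval_basis_self hx.injOn (hS p)
    · by_contra hne
      rw [Finset.prod_eq_zero_iff] at hne
      push Not at hne
      -- A nonzero product forces `a` to agree with `a₀` wherever `a p` is a node. On `Q` it always
      -- is, so `a` contains L and therefore lies in M; then every entry is a node.
      have hval : ∀ p, a p ∈ S p → a p = a₀ p := fun p hp => by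
        by_contra hap
        exact hne p (mem_univ p) (Lagrange.eval_basis_of_ne (Ne.symm hap) hp)
      have hLsub : L ⊆ univ.image a := fun v hv => by
        refine mem_image.2 ⟨pos ⟨v, hv⟩, mem_univ _, ?_⟩
        rw [hval _ _, hpos ⟨v, hv⟩]
        have : pos ⟨v, hv⟩ ∈ Q := mem_image_of_mem _ (mem_univ _)
        simp [S, this, colorClass, ha]
      refine h (funext fun p => hval p ?_)
      have : a p ∈ M := haLM hLsub (mem_image_of_mem _ (mem_univ p))
      by_cases hp : p ∈ Q <;> simp [S, hp, colorClass, ha, this]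

/-- Induction backwards along the collapses. A function that is right on the tuples of `K'` is
corrected on the removed tuples by isolating functions, which vanish on all other face tuples of `K`
and so spoil nothing. -/
theorem exists_mem_monomialSpan_eqOn {x : N → ℝ} (hx : Function.Injective x) {d : ℕ}
    {r : Fin c → ℕ} {K : SComplex N} (hK : Collapsible d K)
    (hr : ∀ A ∈ K, ∀ i, (A.filter fun v => color v = i).card ≤ r i) (φ : (P → N) → ℝ) :
    ∃ g ∈ monomialSpan x (fun p => (colorClass color (col p)).card) (fun p => r (col p)) d,
      ∀ a ∈ faceTuples color col K, g a = φ a := by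
  classical
  induction hK using Relation.ReflTransGen.head_induction_on with
  | refl => exact ⟨0, Submodule.zero_mem _, fun a ha => absurd (mem_faceTuples.1 ha).2 (by simp)⟩
  | @head K K' hstep _ ih =>
    obtain ⟨L, hLK, M, hMK, hdim, hmax, hK'⟩ := hstep
    have hLd : L.card ≤ d := by unfold faceDim at hdim; omega
    obtain ⟨g', hg', hgφ⟩ := ih fun A hA => hr A ((hK' A).1 hA).1
    let T : Finset (P → N) := (faceTuples color col K).filter fun a => L ⊆ univ.image a
    have hiso : ∀ a₀ : P → N, ∃ g ∈ monomialSpan x (fun p => (colorClass color (col p)).card)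
        (fun p => r (col p)) d, a₀ ∈ T →
          ∀ a ∈ faceTuples color col K, g a = if a = a₀ then 1 else 0 := by
      intro a₀
      by_cases h : a₀ ∈ T
      · obtain ⟨ha₀, hL⟩ := mem_filter.1 h
        rw [mem_faceTuples] at ha₀
        obtain ⟨g, hg, hga⟩ := exists_isolating_mem_monomialSpan hx hLd (hr M hMK) ha₀.1 hL
          (subset_of_unique_maximal hmax ha₀.2 hL)
        refine ⟨g, hg, fun _ a ha => ?_⟩
        rw [mem_faceTuples] at ha
        exact hga a ha.1 fun hLa => subset_of_unique_maximal hmax ha.2 hLa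
      · exact ⟨0, Submodule.zero_mem _, fun h' => absurd h' h⟩
    choose e he hea using hiso
    refine ⟨g' + ∑ a₀ ∈ T, (φ a₀ - g' a₀) • e a₀, Submodule.add_mem _ hg'
      (Submodule.sum_mem _ fun a₀ _ => Submodule.smul_mem _ _ (he a₀)), fun a ha => ?_⟩
    have hsum : (∑ a₀ ∈ T, (φ a₀ - g' a₀) • e a₀) a = if a ∈ T then φ a - g' a else 0 := by
      rw [Finset.sum_apply, Finset.sum_congr rfl
        (g := fun a₀ => if a = a₀ then φ a₀ - g' a₀ else 0), Finset.sum_ite_eq]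
      intro a₀ ha₀
      rw [Pi.smul_apply, hea a₀ ha₀ a ha, smul_eq_mul, mul_ite, mul_one, mul_zero]
    rw [Pi.add_apply, hsum]
    split_ifs with haT
    · ring
    · rw [add_zero]
      refine hgφ a (mem_faceTuples.2 ⟨(mem_faceTuples.1 ha).1, (hK' _).2
        ⟨(mem_faceTuples.1 ha).2, fun hL => haT (mem_filter.2 ⟨ha, hL⟩)⟩⟩)

/-- Dimension comparison: restriction to the face tuples maps the span of the monomials onto the
space of all functions there. -/
theorem card_faceTuples_le {d : ℕ} {r : Fin c → ℕ} {K : SComplex N} (hK : Collapsible d K)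
    (hr : ∀ A ∈ K, ∀ i, (A.filter fun v => color v = i).card ≤ r i) :
    (faceTuples color col K).card ≤ (univ.filter fun j : ∀ p,
      Fin (colorClass color (col p)).card =>
        (univ.filter fun p => r (col p) ≤ (j p : ℕ)).card ≤ d).card := by
  classical
  let x : N → ℝ := fun v => ((Fintype.equivFin N v : ℕ) : ℝ)
  have hx : Function.Injective x := fun v w h => by
    simpa [x, Fin.val_inj] using h
  let G := monomialSpan x (fun p => (colorClass color (col p)).card) (fun p => r (col p)) d
  let res : G →ₗ[ℝ] (faceTuples color col K → ℝ) :=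
    (LinearMap.funLeft ℝ ℝ (Subtype.val : faceTuples color col K → (P → N))).comp G.subtype
  have hres : Function.Surjective res := by
    intro φ
    obtain ⟨g, hg, hgφ⟩ := exists_mem_monomialSpan_eqOn (color := color) (col := col) hx hK hr
      (fun a => if h : a ∈ faceTuples color col K then φ ⟨a, h⟩ else 0)
    refine ⟨⟨g, hg⟩, funext fun a => ?_⟩
    have := hgφ a.1 a.2
    simpa [res, LinearMap.funLeft_apply] using this
  have h1 := LinearMap.finrank_le_finrank_of_surjective hres
  rw [Module.finrank_fintype_fun_eq_card, Fintype.card_coe] at h1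
  refine h1.trans ((finrank_range_le_card _).trans ?_)
  rw [Fintype.card_coe]

end Tuples

/-! ### From tuples to sets by random color-preserving permutations, and part (a) -/

section Averaging

variable {N : Type*} [Fintype N] {c : ℕ} {color : N → Fin c}

/-- Color-preserving permutations act transitively on the sets of a given color type. -/
theorem exists_perm_map_eq {k : Fin c → ℕ} {A B : Finset N} (hA : A ∈ colorfulSets color k)
    (hB : B ∈ colorfulSets color k) :
    ∃ σ : Equiv.Perm N, (∀ v, color (σ v) = color v) ∧ A.map σ.toEmbedding = B := by
  classical
  have key : ∀ p q : N → Prop, (∀ i, Fintype.card {v : {v // p v} // color v = i} =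
      Fintype.card {v : {v // q v} // color v = i}) →
      ∃ e : {v // p v} ≃ {v // q v}, ∀ v, color (e v) = color v := by
    intro p q h
    let e : {v // p v} ≃ {v // q v} :=
      (Equiv.sigmaFiberEquiv fun v : {v // p v} => color v).symm.trans
        ((Equiv.sigmaCongrRight fun i => Fintype.equivOfCardEq (h i)).trans
          (Equiv.sigmaFiberEquiv fun v : {v // q v} => color v))
    refine ⟨e, fun v => ?_⟩
    exact (Fintype.equivOfCardEq (h (color v)) ⟨v, rfl⟩).2
  simp only [colorfulSets, mem_filter, mem_univ, true_and] at hA hB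
  have card_eq : ∀ (p : N → Prop) (i : Fin c), Fintype.card {v : {v // p v} // color v = i} =
      (univ.filter fun v => p v ∧ color v = i).card := by
    intro p i
    rw [Fintype.card_congr (Equiv.subtypeSubtypeEquivSubtypeInter p fun v => color v = i),
      Fintype.card_subtype]
  have hin : ∀ (E : Finset N) (i : Fin c), (univ.filter fun v => v ∈ E ∧ color v = i).card =
      (E.filter fun v => color v = i).card := fun E i => congrArg _ (by ext; simp)
  have hsum : ∀ (E : Finset N) (i : Fin c), (univ.filter fun v => v ∈ E ∧ color v = i).card +
      (univ.filter fun v => v ∉ E ∧ color v = i).card =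
      (univ.filter fun v => color v = i).card := fun E i => by
    rw [← Finset.card_filter_add_card_filter_not (s := univ.filter fun v => color v = i)
      (fun v => v ∈ E), Finset.filter_filter, Finset.filter_filter]
    simp only [and_comm]
  obtain ⟨e, he⟩ := key (· ∈ A) (· ∈ B) fun i => by
    rw [card_eq, card_eq]
    convert ((hin A i).trans (hA i)).trans ((hin B i).trans (hB i)).symm
  obtain ⟨f, hf⟩ := key (· ∉ A) (· ∉ B) fun i => by
    rw [card_eq, card_eq]
    have h1 := hsum A i
    have h2 := hsum B i
    rw [hin, hA] at h1
    rw [hin, hB] at h2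
    have h3 : (univ.filter fun v => v ∉ A ∧ color v = i).card =
        (univ.filter fun v => v ∉ B ∧ color v = i).card := by omega
    convert h3
  let σ : Equiv.Perm N := (Equiv.sumCompl (· ∈ A)).symm.trans
    ((Equiv.sumCongr e f).trans (Equiv.sumCompl (· ∈ B)))
  have hσA : ∀ v (h : v ∈ A), σ v = e ⟨v, h⟩ := fun v h => by
    simp [σ, Equiv.sumCompl_symm_apply_of_pos (p := (· ∈ A)) h]
  have hσn : ∀ v (h : v ∉ A), σ v = f ⟨v, h⟩ := fun v h => by
    simp [σ, Equiv.sumCompl_symm_apply_of_neg (p := (· ∈ A)) h]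
  refine ⟨σ, fun v => ?_, ?_⟩
  · by_cases h : v ∈ A
    · rw [hσA v h, he]
    · rw [hσn v h, hf]
  · refine Finset.eq_of_subset_of_card_le (fun w hw => ?_) ?_
    · obtain ⟨v, hv, rfl⟩ := mem_map.1 hw
      simp [hσA v hv]
    · rw [Finset.card_map, Finset.card_eq_sum_card_fiberwise (f := color) (t := univ) (by simp),
        Finset.card_eq_sum_card_fiberwise (s := A) (f := color) (t := univ) (by simp)]
      simp [hA, hB]

variable (color) in
open Classical in
/-- The color-preserving permutations. -/
noncomputable def colorPerms : Finset (Equiv.Perm N) :=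
  univ.filter fun σ => ∀ v, color (σ v) = color v

theorem map_mem_colorfulSets_iff {k : Fin c → ℕ} {σ : Equiv.Perm N}
    (hσ : σ ∈ colorPerms color) {A : Finset N} :
    A.map σ.toEmbedding ∈ colorfulSets color k ↔ A ∈ colorfulSets color k := by
  simp only [colorPerms, mem_filter, mem_univ, true_and] at hσ
  simp only [colorfulSets, mem_filter, mem_univ, true_and, Finset.filter_map, Finset.card_map,
    Function.comp_def, Equiv.coe_toEmbedding, hσ]

open Classical in
/-- Under a random color-preserving permutation, a colorful set becomes a uniformly distributed
colorful set. -/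
theorem card_colorfulSets_mul_card_filter (K : SComplex N) {k : Fin c → ℕ} {A : Finset N}
    (hA : A ∈ colorfulSets color k) :
    (colorfulSets color k).card *
        ((colorPerms color).filter fun σ => A.map σ.toEmbedding ∈ K).card =
      (colorPerms color).card * (colorfulFaces K color k).card := by
  -- By transitivity this count does not depend on the colorful set. The identity then follows from
  -- counting the pairs (B, σ) with σ(B) in K in two ways.
  have h1 : ∀ B ∈ colorfulSets color k,
      ((colorPerms color).filter fun σ => B.map σ.toEmbedding ∈ K).card =
        ((colorPerms color).filter fun σ => A.map σ.toEmbedding ∈ K).card := by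
    intro B hB
    obtain ⟨τ, hτ, rfl⟩ := exists_perm_map_eq hA hB
    have hτ' : ∀ v, color (τ⁻¹ v) = color v := fun v => by
      have := hτ (τ⁻¹ v)
      simpa using this.symm
    refine Finset.card_bij' (fun σ _ => σ * τ) (fun σ _ => σ * τ⁻¹) ?_ ?_ ?_ ?_
    · intro σ hσ
      simp only [colorPerms, mem_filter, mem_univ, true_and] at hσ ⊢
      refine ⟨fun v => by simp [hσ.1, hτ], ?_⟩
      convert hσ.2 using 1
      rw [Finset.map_map]; rfl
    · intro σ hσ
      simp only [colorPerms, mem_filter, mem_univ, true_and] at hσ ⊢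
      refine ⟨fun v => by simp only [Equiv.Perm.coe_mul, Function.comp_apply, hσ.1, hτ'], ?_⟩
      convert hσ.2 using 1
      rw [Finset.map_map]; ext v; simp [-Finset.mem_map_equiv, Finset.mem_map]
    · intro σ _; simp
    · intro σ _; simp
  have h2 : ∀ σ ∈ colorPerms color, ((colorfulSets color k).filter
      fun B => B.map σ.toEmbedding ∈ K).card = (colorfulFaces K color k).card := by
    intro σ hσ
    refine Finset.card_bij' (fun B _ => B.map σ.toEmbedding)
      (fun B _ => B.map σ.symm.toEmbedding) ?_ ?_ ?_ ?_
    · intro B hB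
      simp only [colorfulFaces, mem_filter] at hB ⊢
      exact ⟨(map_mem_colorfulSets_iff hσ).2 hB.1, hB.2⟩
    · intro B hB
      have hB' : (B.map σ.symm.toEmbedding).map σ.toEmbedding = B := by
        ext; simp
      simp only [colorfulFaces, mem_filter] at hB ⊢
      rw [← map_mem_colorfulSets_iff hσ, hB']
      exact hB
    · intro B _; ext; simp
    · intro B _; ext; simp
  have h3 := Finset.sum_card_bipartiteAbove_eq_sum_card_bipartiteBelow
    (s := colorfulSets color k) (t := colorPerms color)
    (fun B (σ : Equiv.Perm N) => B.map σ.toEmbedding ∈ K)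
  simp only [Finset.bipartiteAbove, Finset.bipartiteBelow] at h3
  rwa [Finset.sum_congr rfl h1, Finset.sum_congr rfl h2, Finset.sum_const, Finset.sum_const,
    smul_eq_mul, smul_eq_mul] at h3

open Classical in
/-- Sampling with replacement is at least as likely to give a face as sampling without. -/
theorem card_colorfulFaces_mul_prod_le (K : SComplex N) {k : Fin c → ℕ}
    (hk : ∀ i, k i ≤ (colorClass color i).card) :
    (colorfulFaces K color k).card * ∏ p : Σ i, Fin (k i), (colorClass color p.1).card ≤
      (colorfulSets color k).card *
        (faceTuples color (fun p : Σ i, Fin (k i) => p.1) K).card := by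
  let T : Finset ((Σ i, Fin (k i)) → N) := Fintype.piFinset fun p => colorClass color p.1
  let R : ((Σ i, Fin (k i)) → N) → Equiv.Perm N → Prop := fun a σ => univ.image (σ ∘ a) ∈ K
  have hT : T.card = ∏ p : Σ i, Fin (k i), (colorClass color p.1).card :=
    Fintype.card_piFinset _
  have hmemT : ∀ a, a ∈ T ↔ ∀ p, color (a p) = p.1 := fun a => by simp [T, colorClass]
  have hpos : 0 < (colorPerms color).card :=
    Finset.card_pos.2 ⟨1, by simp [colorPerms]⟩
  have h1 : ∀ a ∈ T, (colorPerms color).card * (colorfulFaces K color k).card ≤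
      (colorfulSets color k).card *
        ((colorPerms color).filter fun σ => R a σ).card := by
    intro a ha
    -- A tuple may repeat vertices, so its entries are padded to a colorful set `A`. Every
    -- permutation sending `A` to a face also sends the tuple to a face tuple.
    have hE : ∀ i, ∃ E : Finset N, (univ.image fun m : Fin (k i) => a ⟨i, m⟩) ⊆ E ∧
        E ⊆ colorClass color i ∧ E.card = k i := fun i =>
      Finset.exists_subsuperset_card_eq
        (fun v hv => by
          obtain ⟨m, _, rfl⟩ := mem_image.1 hv
          simpa [colorClass] using (hmemT a).1 ha ⟨i, m⟩)
        (Finset.card_image_le.trans (by simp)) (hk i)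
    choose E haE hEc hEk using hE
    let A : Finset N := univ.biUnion E
    have hA : A ∈ colorfulSets color k := by
      simp only [colorfulSets, mem_filter, mem_univ, true_and]
      intro i
      rw [← hEk i]
      congr 1
      ext v
      simp only [A, mem_filter, mem_biUnion, mem_univ, true_and]
      constructor
      · rintro ⟨⟨j, hj⟩, rfl⟩
        have := hEc j hj
        simp only [colorClass, mem_filter, mem_univ, true_and] at this
        rwa [this]
      · intro hv
        exact ⟨⟨i, hv⟩, by simpa [colorClass] using hEc i hv⟩
    rw [← card_colorfulSets_mul_card_filter K hA]
    refine Nat.mul_le_mul_left _ (Finset.card_le_card fun σ hσ => ?_)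
    simp only [mem_filter] at hσ ⊢
    refine ⟨hσ.1, K.lower ?_ hσ.2⟩
    intro w hw
    obtain ⟨p, _, rfl⟩ := mem_image.1 hw
    refine mem_map.2 ⟨a p, mem_biUnion.2 ⟨p.1, mem_univ _, haE p.1 ?_⟩, rfl⟩
    exact mem_image.2 ⟨p.2, mem_univ _, rfl⟩
  have h2 : ∀ σ ∈ colorPerms color, (T.filter fun a => R a σ).card =
      (faceTuples color (fun p : Σ i, Fin (k i) => p.1) K).card := by
    intro σ hσ
    simp only [colorPerms, mem_filter, mem_univ, true_and] at hσ
    refine Finset.card_bij' (fun a _ => σ ∘ a) (fun a _ => σ.symm ∘ a) ?_ ?_ ?_ ?_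
    · intro a ha
      rw [mem_filter, hmemT] at ha
      exact mem_faceTuples.2 ⟨fun p => by simp [hσ, ha.1], ha.2⟩
    · intro a ha
      rw [mem_faceTuples] at ha
      rw [mem_filter, hmemT]
      refine ⟨fun p => ?_, by simpa [R, ← Function.comp_assoc] using ha.2⟩
      rw [← ha.1 p, ← hσ]; simp
    · intro a _; ext; simp
    · intro a _; ext; simp
  have h3 := Finset.sum_card_bipartiteAbove_eq_sum_card_bipartiteBelow
    (s := T) (t := colorPerms color) R
  simp only [Finset.bipartiteAbove, Finset.bipartiteBelow] at h3
  rw [Finset.sum_congr rfl h2, Finset.sum_const, smul_eq_mul] at h3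
  have h4 := Finset.sum_le_sum h1
  rw [← Finset.mul_sum, ← Finset.mul_sum, h3, Finset.sum_const, smul_eq_mul, hT] at h4
  refine Nat.le_of_mul_le_mul_left ?_ hpos
  calc _ = _ := by ring
    _ ≤ _ := h4
    _ = _ := by ring

/-- The fractional colorful Helly theorem for `d`-collapsible complexes. -/
theorem Collapsible.exists_le_dim {d : ℕ} {k : Fin c → ℕ} (hk : d + 1 ≤ ∑ i, k i)
    {β : Fin c → ℝ} (hβ : ∀ i, 0 < β i ∧ β i ≤ 1) {K : SComplex N}
    (hkn : ∀ i, k i ≤ (colorClass color i).card) (hK : Collapsible d K)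
    (hα : alpha k d β * ((colorfulSets color k).card : ℝ) ≤ ((colorfulFaces K color k).card : ℝ)) :
    ∃ i, β i * ((colorClass color i).card : ℝ) - 1 ≤
      (dim (induced K (colorClass color i)) : ℝ) := by
  classical
  by_contra! hcon
  let r : Fin c → ℕ := fun i => (univ.filter fun A : Finset N =>
    A ∈ induced K (colorClass color i)).sup Finset.card
  have hdim : ∀ i, (dim (induced K (colorClass color i)) : ℝ) = r i - 1 := fun i => by
    simp only [dim, r]
    push_cast
    congr!
  have hrβ : ∀ i, (r i : ℝ) < β i * (colorClass color i).card := fun i => by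
    have := hcon i
    rw [hdim] at this
    linarith
  -- An empty class would have dimension -1, which already satisfies the desired conclusion.
  have hn : ∀ i, 0 < (colorClass color i).card := fun i => by
    rcases Nat.eq_zero_or_pos (colorClass color i).card with h | h
    · have h1 := hrβ i
      rw [h] at h1
      have h2 : (0 : ℝ) ≤ r i := Nat.cast_nonneg _
      norm_num at h1
      linarith
    · exact h
  have hn' : ∀ i, (0 : ℝ) < (colorClass color i).card := fun i => by exact_mod_cast hn i
  have hrK : ∀ A ∈ K, ∀ i, (A.filter fun v => color v = i).card ≤ r i := fun A hA i =>
    Finset.le_sup (f := Finset.card) (mem_filter.2 ⟨mem_univ _, K.lower (filter_subset _ _) hA,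
      fun v hv => by simpa [colorClass] using (mem_filter.1 hv).2⟩)
  have hrn : ∀ i, r i ≤ (colorClass color i).card := fun i =>
    Finset.sup_le fun A hA => Finset.card_le_card (mem_filter.1 hA).2.2
  have hcard := card_faceTuples_le (col := fun p : Σ i, Fin (k i) => p.1) hK hrK
  have hcard' : ((faceTuples color (fun p : Σ i, Fin (k i) => p.1) K).card : ℝ) ≤ _ :=
    Nat.cast_le.2 hcard
  rw [card_filter_card_le d (fun p : Σ i, Fin (k i) => (colorClass color p.1).card)
    (fun p => r p.1) (fun p => hn p.1) (fun p => hrn p.1)] at hcard'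
  have hlt : atMost d (fun p : Σ i, Fin (k i) => (r p.1 : ℝ) / (colorClass color p.1).card) <
      alpha k d β := by
    rw [alpha_eq_atMost]
    refine atMost_lt_atMost (by simpa using hk) (fun p => by positivity) (fun p => ?_)
      fun p => (hβ p.1).2
    rw [div_lt_iff₀ (hn' p.1)]
    exact hrβ p.1
  have havg : ((colorfulFaces K color k).card : ℝ) *
      ∏ p : Σ i, Fin (k i), ((colorClass color p.1).card : ℝ) ≤
      (colorfulSets color k).card *
        (faceTuples color (fun p : Σ i, Fin (k i) => p.1) K).card := by
    exact_mod_cast card_colorfulFaces_mul_prod_le K hkn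
  have hsets : (0 : ℝ) < (colorfulSets color k).card := by
    have hE : ∀ i, ∃ E ⊆ colorClass color i, E.card = k i := fun i =>
      Finset.exists_subset_card_eq (hkn i)
    choose E hE hEk using hE
    refine Nat.cast_pos.2 (Finset.card_pos.2 ⟨univ.biUnion E, ?_⟩)
    simp only [colorfulSets, mem_filter, mem_univ, true_and]
    intro i
    rw [← hEk i]
    congr 1
    ext v
    have hcol : ∀ j, v ∈ E j → color v = j := fun j hj => by simpa [colorClass] using hE j hj
    simp only [mem_filter, mem_biUnion, mem_univ, true_and]
    constructor
    · rintro ⟨⟨j, hj⟩, rfl⟩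
      rwa [hcol j hj]
    · exact fun hv => ⟨⟨i, hv⟩, hcol i hv⟩
  have hprod : (0 : ℝ) < ∏ p : Σ i, Fin (k i), ((colorClass color p.1).card : ℝ) :=
    Finset.prod_pos fun p _ => hn' p.1
  have := mul_le_mul_of_nonneg_right hα hprod.le
  have h2 := mul_le_mul_of_nonneg_left hcard' hsets.le
  have h3 := mul_lt_mul_of_pos_left (mul_lt_mul_of_pos_right hlt hprod) hsets
  linarith

end Averaging
-- The extremal complex: collapsibility and representability
section Hyperplanes

variable {N : Type*} (h : N → Prop) [DecidablePred h]

/-- The join of the `(d - 1)`-skeleton of the simplex on the vertices satisfying `h` with the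
simplex on the other vertices. -/
def skeletonJoin (d : ℕ) : SComplex N where
  carrier := {A | (A.filter h).card ≤ d}
  lower' := fun _ _ hBA hA => (Finset.card_le_card (Finset.filter_subset_filter _ hBA)).trans hA

variable {h}

theorem mem_skeletonJoin {d : ℕ} {A : Finset N} :
    A ∈ skeletonJoin h d ↔ (A.filter h).card ≤ d := Iff.rfl

/-- The generality serves the induction: a collapse leaves the class of skeleton joins, but
membership still depends only on the vertices satisfying `h`. If L is maximal among the faces with
all vertices in `h`, then L together with all vertices outside `h` is the unique maximal face above
L. -/
theorem collapsible_of_mem_iff_filter_mem [Fintype N] {d : ℕ} (K : SComplex N)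
    (htr : ∀ A, A ∈ K ↔ A.filter h ∈ K) (hd : ∀ A ∈ K, (A.filter h).card ≤ d) :
    Collapsible d K := by
  classical
  have : Finite (SComplex N) := Finite.of_injective (fun K : SComplex N => (K : Set (Finset N)))
    SetLike.coe_injective
  induction K using WellFoundedLT.induction with
  | ind K ih =>
    by_cases hK : ∃ A, A ∈ K
    · obtain ⟨A₀, hA₀⟩ := hK
      obtain ⟨L, -, hL⟩ := (Set.toFinite {A : Finset N | A ∈ K ∧ A.filter h = A}).exists_le_maximal
        (show A₀.filter h ∈ {A : Finset N | A ∈ K ∧ A.filter h = A} from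
          ⟨(htr _).1 hA₀, by simp [Finset.filter_filter]⟩)
      have hLK : L ∈ K := hL.1.1
      have hLh : ∀ v ∈ L, h v := Finset.filter_eq_self.1 hL.1.2
      let M := L ∪ univ.filter fun v => ¬ h v
      have hMf : M.filter h = L := by
        ext v
        simp only [M, mem_filter, mem_union, mem_univ, true_and]
        exact ⟨fun hv => hv.1.resolve_right (not_not.2 hv.2), fun hv => ⟨Or.inl hv, hLh v hv⟩⟩
      have hMK : M ∈ K := by rw [htr, hMf]; exact hLK
      have hsub : ∀ A, L ⊆ A ↔ L ⊆ A.filter h := fun A =>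
        ⟨fun hA v hv => mem_filter.2 ⟨hA hv, hLh v hv⟩, fun hA => hA.trans (filter_subset _ _)⟩
      have hAM : ∀ A ∈ K, L ⊆ A → A ⊆ M := fun A hA hLA v hv => by
        by_cases hhv : h v
        · exact mem_union_left _ (hL.2 (y := A.filter h)
            ⟨(htr _).1 hA, by simp [Finset.filter_filter]⟩ ((hsub A).1 hLA)
            (mem_filter.2 ⟨hv, hhv⟩))
        · exact mem_union_right _ (by simpa using hhv)
      let K' : SComplex N :=
        { carrier := {A | A ∈ K ∧ ¬ L ⊆ A}
          lower' := fun A B hBA hA => ⟨K.lower hBA hA.1, fun hLB => hA.2 (hLB.trans hBA)⟩ }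
      have hK' : ∀ A, A ∈ K' ↔ A ∈ K ∧ ¬ L ⊆ A := fun A => Iff.rfl
      refine Relation.ReflTransGen.head (b := K') ?_ (ih K' ?_ ?_ ?_)
      · refine ⟨L, hLK, M, hMK, ?_, fun A => ⟨fun hA => ?_, ?_⟩, hK'⟩
        · have := hd L hLK
          rw [hL.1.2] at this
          unfold faceDim
          omega
        · exact hA.eq_of_le ⟨hMK, subset_union_left⟩ (hAM A hA.1.1 hA.1.2)
        · rintro rfl
          exact ⟨⟨hMK, subset_union_left⟩, fun B hB _ => hAM B hB.1 hB.2⟩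
      · exact lt_of_le_of_ne (fun A hA => hA.1) fun heq =>
          ((hK' L).1 (heq ▸ hLK)).2 Subset.rfl
      · intro A
        rw [hK', hK', ← htr, ← hsub]
      · exact fun A hA => hd A hA.1
    · have : K = ⊥ := by
        ext A
        exact ⟨fun hA => (hK ⟨A, hA⟩).elim, fun hA => hA.elim⟩
      rw [this]
      exact Relation.ReflTransGen.refl

theorem collapsible_skeletonJoin [Fintype N] (d : ℕ) : Collapsible d (skeletonJoin h d) :=
  collapsible_of_mem_iff_filter_mem (h := h) _
    (fun A => by simp [mem_skeletonJoin, Finset.filter_filter]) fun _ hA => hA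

open Polynomial in
/-- The nerve of a family of hyperplanes in general position and copies of the whole space. -/
theorem representable_skeletonJoin [Fintype N] (d : ℕ) : Representable d (skeletonJoin h d) := by
  classical
  let t : N → ℝ := fun v => ((Fintype.equivFin N v : ℕ) : ℝ)
  have ht : Function.Injective t := fun v w hvw => by
    simpa [t, Fin.val_inj] using hvw
  -- A point x encodes the monic polynomial X^d - ∑ x_j X^j, and the hyperplane of v says that `t v`
  -- is a root. Such a polynomial has at most d roots, and any d or fewer values occur among its
  -- roots.
  let F : N → Set (EuclideanSpace ℝ (Fin d)) := fun v =>
    {x | h v → ∑ j : Fin d, x j * t v ^ (j : ℕ) = t v ^ d}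
  refine ⟨F, fun v x hx y hy a b _ _ hab hv => ?_, fun A => ?_⟩
  · have h1 := hx hv
    have h2 := hy hv
    simp only [PiLp.add_apply, PiLp.smul_apply, smul_eq_mul, add_mul, Finset.sum_add_distrib,
      mul_assoc, ← Finset.mul_sum, h1, h2]
    rw [← add_mul, hab, one_mul]
  · rw [mem_skeletonJoin]
    constructor
    · intro hA
      -- The power of X raises the degree to exactly d.
      let q : ℝ[X] := (∏ v ∈ A.filter h, (X - C (t v))) * X ^ (d - (A.filter h).card)
      have hq : q.Monic := (monic_prod_X_sub_C _ _).mul (monic_X_pow _)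
      have hdeg : q.natDegree = d := by
        rw [(monic_prod_X_sub_C _ _).natDegree_mul (monic_X_pow _), natDegree_X_pow,
          natDegree_finsetProd_X_sub_C_eq_card]
        omega
      refine ⟨WithLp.toLp 2 fun j : Fin d => - q.coeff j, Set.mem_iInter₂.2 fun v hv hhv => ?_⟩
      have h0 : q.eval (t v) = 0 := by
        rw [eval_mul, eval_prod, Finset.prod_eq_zero (mem_filter.2 ⟨hv, hhv⟩) (by simp), zero_mul]
      rw [eval_eq_sum_range, hdeg, Finset.sum_range_succ, Finset.sum_range] at h0
      have hlead : q.coeff d = 1 := by rw [← hdeg]; exact hq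
      rw [hlead, one_mul] at h0
      simp only [neg_mul, Finset.sum_neg_distrib]
      linarith
    · rintro ⟨x, hx⟩
      let s : ℝ[X] := ∑ j : Fin d, C (x j) * X ^ (j : ℕ)
      have hs : s.degree < d := degree_sum_fin_lt _
      have hmon : (X ^ d - s).Monic := monic_X_pow_sub hs
      have hdeg : (X ^ d - s).natDegree = d := by
        refine natDegree_eq_of_degree_eq_some ?_
        rw [degree_sub_eq_left_of_degree_lt (by rwa [degree_X_pow]), degree_X_pow]
      have hroots : ((A.filter h).image t).val ⊆ (X ^ d - s).roots := by
        intro y hy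
        obtain ⟨v, hv, rfl⟩ := mem_image.1 hy
        obtain ⟨hvA, hhv⟩ := mem_filter.1 hv
        rw [mem_roots hmon.ne_zero, IsRoot.def]
        have : ∑ j : Fin d, x j * t v ^ (j : ℕ) = t v ^ d := Set.mem_iInter₂.1 hx v hvA hhv
        simp [s, eval_finsetSum, this]
      have := card_le_degree_of_subset_roots hroots
      rwa [Finset.card_image_of_injective _ ht, hdeg] at this

end Hyperplanes

/-! ### Counting colorful faces of the extremal complex -/

section Counting

variable {c : ℕ}

theorem card_finsetSigmaEquiv_apply_filter {n : ℕ} (A : Finset (Σ _ : Fin c, Fin n)) (i : Fin c)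
    (h : (Σ _ : Fin c, Fin n) → Prop) [DecidablePred h] :
    ((finsetSigmaEquiv (fun _ : Fin c => Fin n) A i).filter fun x => h ⟨i, x⟩).card =
      ((A.filter h).filter fun v => v.1 = i).card := by
  rw [← Finset.card_map (Function.Embedding.sigmaMk (β := fun _ : Fin c => Fin n) i)]
  congr 1
  ext ⟨j, x⟩
  simp only [finsetSigmaEquiv, Equiv.coe_fn_mk, mem_map, mem_filter, mem_univ, true_and,
    Function.Embedding.sigmaMk_apply]
  constructor
  · rintro ⟨y, hy, heq⟩
    cases heq
    exact ⟨hy, rfl⟩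
  · rintro ⟨hA, rfl⟩
    exact ⟨x, hA, rfl⟩

theorem card_finsetSigmaEquiv_apply {n : ℕ} (A : Finset (Σ _ : Fin c, Fin n)) (i : Fin c) :
    (finsetSigmaEquiv (fun _ : Fin c => Fin n) A i).card =
      (A.filter fun v => v.1 = i).card := by
  simpa using card_finsetSigmaEquiv_apply_filter A i fun _ => True

theorem card_colorfulSets_sigma_fin (k : Fin c → ℕ) (n : ℕ) :
    (colorfulSets (N := Σ _ : Fin c, Fin n) Sigma.fst k).card = ∏ i, n.choose (k i) := by
  have : (colorfulSets (N := Σ _ : Fin c, Fin n) Sigma.fst k).card =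
      (Fintype.piFinset fun i => powersetCard (k i) (univ : Finset (Fin n))).card := by
    refine Finset.card_equiv (finsetSigmaEquiv fun _ : Fin c => Fin n) fun A => ?_
    simp only [colorfulSets, mem_filter, mem_univ, true_and, Fintype.mem_piFinset,
      mem_powersetCard, subset_univ, card_finsetSigmaEquiv_apply]
  simp [this]

theorem choose_mul_choose_le_card_filter {X : Type*} [Fintype X] [DecidableEq X] (h : X → Prop)
    [DecidablePred h] {l k : ℕ} (hl : l ≤ k) :
    (univ.filter h).card.choose l * (univ.filter fun x => ¬ h x).card.choose (k - l) ≤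
      (univ.filter fun s : Finset X => s.card = k ∧ (s.filter h).card = l).card := by
  rw [← Finset.card_powersetCard, ← Finset.card_powersetCard, ← Finset.card_product]
  have hf : ∀ a ⊆ univ.filter h, ∀ b ⊆ univ.filter (fun x => ¬ h x),
      (a ∪ b).filter h = a ∧ (a ∪ b).filter (fun x => ¬ h x) = b := by
    intro a ha b hb
    constructor <;> ext x <;> have h1 := @ha x <;> have h2 := @hb x <;>
      simp only [mem_filter, mem_univ, true_and, mem_union] at h1 h2 ⊢ <;> tauto
  refine Finset.card_le_card_of_injOn (fun ab => ab.1 ∪ ab.2) ?_ ?_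
  · rintro ⟨a, b⟩ hab
    simp only [coe_product, Set.mem_prod, mem_coe, mem_powersetCard] at hab
    obtain ⟨⟨ha, hal⟩, hb, hbl⟩ := hab
    obtain ⟨h1, h2⟩ := hf a ha b hb
    have := Finset.card_filter_add_card_filter_not (s := a ∪ b) h
    rw [h1, h2] at this
    simp only [coe_filter, mem_univ, true_and, Set.mem_ofPred_eq, h1]
    omega
  · rintro ⟨a, b⟩ hab ⟨a', b'⟩ hab' heq
    simp only [coe_product, Set.mem_prod, mem_coe, mem_powersetCard] at hab hab' heq
    obtain ⟨h1, h2⟩ := hf a hab.1.1 b hab.2.1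
    obtain ⟨h1', h2'⟩ := hf a' hab'.1.1 b' hab'.2.1
    rw [heq] at h1 h2
    rw [← h1, ← h2, h1', h2']

/-- Colorful faces are sorted by their numbers `l i` of hyperplanes in each color; these are chosen
among `n - r i` hyperplanes and the rest among `r i` copies of the space. The lower bound suffices
for optimality. -/
theorem sum_prod_choose_le_card_colorfulFaces (k : Fin c → ℕ) (n d : ℕ) (r : Fin c → ℕ)
    (hr : ∀ i, r i ≤ n) :
    ∑ l ∈ indexSet k d, ∏ i, (n - r i).choose (l i) * (r i).choose (k i - l i) ≤
      (colorfulFaces (skeletonJoin (fun v : Σ _ : Fin c, Fin n => r v.1 ≤ (v.2 : ℕ)) d)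
        Sigma.fst k).card := by
  classical
  have hcard : (colorfulFaces (skeletonJoin (fun v : Σ _ : Fin c, Fin n => r v.1 ≤ (v.2 : ℕ)) d)
      Sigma.fst k).card = (univ.filter fun s : Fin c → Finset (Fin n) =>
        (∀ i, (s i).card = k i) ∧
          ∑ i, ((s i).filter fun x : Fin n => r i ≤ (x : ℕ)).card ≤ d).card := by
    refine Finset.card_equiv (finsetSigmaEquiv fun _ : Fin c => Fin n) fun A => ?_
    simp only [colorfulFaces, colorfulSets, mem_filter, mem_univ, true_and,
      card_finsetSigmaEquiv_apply, mem_skeletonJoin]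
    rw [Finset.card_eq_sum_card_fiberwise (s := A.filter _) (f := Sigma.fst) (t := univ) (by simp)]
    simp only [← card_finsetSigmaEquiv_apply_filter]
  rw [hcard, Finset.card_eq_sum_card_fiberwise (t := indexSet k d)
    (f := fun s i => ((s i).filter fun x : Fin n => r i ≤ (x : ℕ)).card)]
  · refine Finset.sum_le_sum fun l hl => ?_
    simp only [indexSet, mem_filter, mem_Iic] at hl
    have hge : ∀ i, (univ.filter fun x : Fin n => r i ≤ (x : ℕ)).card = n - r i ∧
        (univ.filter fun x : Fin n => ¬ r i ≤ (x : ℕ)).card = r i := fun i => by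
      have h1 : (univ.filter fun x : Fin n => ¬ r i ≤ (x : ℕ)).card = r i := by
        simp only [not_le]
        exact Fin.card_filter_val_lt.trans (min_eq_right (hr i))
      have h2 := Finset.card_filter_add_card_filter_not (s := (univ : Finset (Fin n)))
        (fun x : Fin n => r i ≤ (x : ℕ))
      rw [h1, Finset.card_univ, Fintype.card_fin] at h2
      omega
    calc ∏ i, (n - r i).choose (l i) * (r i).choose (k i - l i)
        ≤ ∏ i, (univ.filter fun s : Finset (Fin n) => s.card = k i ∧
            (s.filter fun x : Fin n => r i ≤ (x : ℕ)).card = l i).card := by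
          refine Finset.prod_le_prod' fun i _ => ?_
          have := choose_mul_choose_le_card_filter (fun x : Fin n => r i ≤ (x : ℕ)) (hl.1 i)
          rwa [(hge i).1, (hge i).2] at this
      _ = _ := (Fintype.card_piFinset _).symm
      _ ≤ _ := Finset.card_le_card fun s hs => by
          simp only [Fintype.mem_piFinset, mem_filter, mem_univ, true_and] at hs ⊢
          refine ⟨⟨fun i => (hs i).1, ?_⟩, funext fun i => (hs i).2⟩
          simpa [hs] using hl.2
  · intro s hs
    simp only [coe_filter, mem_univ, true_and, Set.mem_ofPred_eq] at hs
    simp only [indexSet, coe_filter, mem_Iic, Set.mem_ofPred_eq]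
    exact ⟨fun i => (Finset.card_filter_le _ _).trans (hs.1 i).le, hs.2⟩

end Counting

/-! ### Hypergeometric limits and part (b) -/

section Asymptotics

open Filter Topology

theorem tendsto_choose_div_pow {a : ℕ → ℕ} {x : ℝ}
    (ha : Tendsto (fun n => (a n : ℝ) / n) atTop (𝓝 x)) (l : ℕ) :
    Tendsto (fun n => ((a n).choose l : ℝ) / (n : ℝ) ^ l) atTop (𝓝 (x ^ l / l.factorial)) := by
  induction l with
  | zero => simp
  | succ l ih =>
    have h1 : Tendsto (fun n : ℕ => (l : ℝ) / n) atTop (𝓝 0) :=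
      tendsto_const_div_atTop_nhds_zero_nat _
    have h2 := (ih.mul (ha.sub h1)).div_const ((l : ℝ) + 1)
    have h3 : x ^ l / l.factorial * (x - 0) / ((l : ℝ) + 1) =
        x ^ (l + 1) / (l + 1).factorial := by
      rw [Nat.factorial_succ]
      push_cast
      field_simp
      ring
    rw [h3] at h2
    refine h2.congr fun n => ?_
    have h4 : ((a n).choose (l + 1) : ℝ) * (l + 1) = (a n).choose l * (a n - l) := by
      rcases le_or_gt l (a n) with h | h
      · have := Nat.choose_succ_right_eq (a n) l
        rw [← Nat.cast_sub h]
        exact_mod_cast this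
      · rw [Nat.choose_eq_zero_of_lt h, Nat.choose_eq_zero_of_lt (h.trans (Nat.lt_succ_self _))]
        simp
    rw [eq_div_of_mul_eq (by positivity) h4]
    rcases eq_or_ne (n : ℝ) 0 with h | h
    · simp [h]
    · field_simp
      ring

theorem tendsto_hypergeometric {r : ℕ → ℕ} {β : ℝ} (hr : ∀ n, r n ≤ n)
    (hβ : Tendsto (fun n => (r n : ℝ) / n) atTop (𝓝 β)) {l k : ℕ} (hl : l ≤ k) :
    Tendsto (fun n => (((n - r n).choose l * (r n).choose (k - l) : ℕ) : ℝ) / n.choose k) atTop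
      (𝓝 (k.choose l * (1 - β) ^ l * β ^ (k - l))) := by
  have h1 : Tendsto (fun n : ℕ => (n : ℝ) / n) atTop (𝓝 1) :=
    tendsto_const_nhds.congr' (by
      filter_upwards [eventually_gt_atTop 0] with n hn
      rw [div_self (by positivity)])
  have h2 : Tendsto (fun n => ((n - r n : ℕ) : ℝ) / n) atTop (𝓝 (1 - β)) := by
    refine (h1.sub hβ).congr fun n => ?_
    rw [Nat.cast_sub (hr n), sub_div]
  have h3 := ((tendsto_choose_div_pow h2 l).mul (tendsto_choose_div_pow hβ (k - l))).div
    (tendsto_choose_div_pow (a := fun n => n) h1 k) (by positivity)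
  have h4 : (1 - β) ^ l / l.factorial * (β ^ (k - l) / (k - l).factorial) /
      (1 ^ k / k.factorial) = k.choose l * (1 - β) ^ l * β ^ (k - l) := by
    rw [Nat.cast_choose ℝ hl]
    field_simp
    simp
  rw [h4] at h3
  refine h3.congr' ?_
  filter_upwards [eventually_gt_atTop 0] with n hn
  have hn' : (n : ℝ) ≠ 0 := by positivity
  simp only [Pi.div_apply]
  rw [div_mul_div_comm, ← pow_add, Nat.add_sub_cancel' hl, div_div_div_cancel_right₀ (by positivity)]
  push_cast
  rfl

theorem tendsto_ceil_sub_div {β : ℝ} (hβ : 0 < β) (e : ℕ) :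
    Tendsto (fun n : ℕ => ((⌈β * n⌉₊ - e : ℕ) : ℝ) / n) atTop (𝓝 β) := by
  have h0 : Tendsto (fun n : ℕ => β - (e : ℝ) / n) atTop (𝓝 β) := by
    simpa using tendsto_const_nhds.sub (tendsto_const_div_atTop_nhds_zero_nat (e : ℝ))
  have h1 : Tendsto (fun n : ℕ => β + (1 : ℝ) / n) atTop (𝓝 β) := by
    simpa using tendsto_const_nhds.add (tendsto_const_div_atTop_nhds_zero_nat (1 : ℝ))
  refine tendsto_of_tendsto_of_tendsto_of_le_of_le' h0 h1 ?_ ?_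
  · filter_upwards [eventually_gt_atTop 0] with n hn
    have hn' : (0 : ℝ) < n := by positivity
    rw [sub_div' hn'.ne', div_le_div_iff_of_pos_right hn']
    have h2 := Nat.le_ceil (β * n)
    have h3 : (⌈β * n⌉₊ : ℝ) ≤ (⌈β * n⌉₊ - e : ℕ) + e := by exact_mod_cast le_tsub_add
    linarith
  · filter_upwards [eventually_gt_atTop 0] with n hn
    have hn' : (0 : ℝ) < n := by positivity
    rw [add_div' _ _ _ hn'.ne', div_le_div_iff_of_pos_right hn']
    have h2 := Nat.ceil_lt_add_one (show 0 ≤ β * n by positivity)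
    have h3 : ((⌈β * n⌉₊ - e : ℕ) : ℝ) ≤ ⌈β * n⌉₊ := by exact_mod_cast Nat.sub_le _ _
    linarith

/-- Optimality of the bound in the fractional colorful Helly theorem. -/
theorem exists_complex_of_lt_alpha {c d : ℕ} (hd : 1 ≤ d) (k : Fin c → ℕ) {β : Fin c → ℝ}
    (hβ : ∀ i, 0 < β i ∧ β i ≤ 1) {α' : ℝ} (hα : α' < alpha k d β) :
    ∃ (N : Type) (_ : Fintype N) (color : N → Fin c) (K : SComplex N),
      (∀ i, k i ≤ (colorClass color i).card) ∧ (∀ v : N, {v} ∈ K) ∧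
      Representable d K ∧ Collapsible d K ∧
      α' * ((colorfulSets color k).card : ℝ) ≤ ((colorfulFaces K color k).card : ℝ) ∧
      ∀ i, (dim (induced K (colorClass color i)) : ℝ) <
        β i * ((colorClass color i).card : ℝ) - 1 := by
  classical
  -- A face of a single color has at most r + d vertices, so the offset d + 1 keeps it at ⌈βn⌉ - 1 <
  -- βn once the subtraction is not truncated. Being constant, the offset does not affect the limit
  -- of r/n.
  let r : ℕ → Fin c → ℕ := fun n i => ⌈β i * n⌉₊ - (d + 1)
  have hrn : ∀ n i, r n i ≤ n := fun n i => (Nat.sub_le _ _).trans (Nat.ceil_le.2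
    (mul_le_of_le_one_left (Nat.cast_nonneg n) (hβ i).2))
  have hlim : Tendsto (fun n : ℕ => ∑ l ∈ indexSet k d, ∏ i,
      (((n - r n i).choose (l i) * (r n i).choose (k i - l i) : ℕ) : ℝ) / n.choose (k i)) atTop
      (𝓝 (alpha k d β)) := by
    refine tendsto_finsetSum _ fun l hl => tendsto_finsetProd _ fun i _ => ?_
    simp only [indexSet, mem_filter, mem_Iic] at hl
    exact tendsto_hypergeometric (fun n => hrn n i) (tendsto_ceil_sub_div (hβ i).1 _) (hl.1 i)
  have hev1 : ∀ᶠ n : ℕ in atTop, ∀ i, k i ≤ n :=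
    eventually_all.2 fun i => eventually_ge_atTop _
  have hev2 : ∀ᶠ n : ℕ in atTop, ∀ i, (d + 1 : ℝ) ≤ β i * n :=
    eventually_all.2 fun i =>
      (tendsto_natCast_atTop_atTop.const_mul_atTop (hβ i).1).eventually_ge_atTop _
  obtain ⟨n, ⟨hn, hkn⟩, hβn⟩ := (((hlim.eventually_const_lt hα).and hev1).and hev2).exists
  have hclass : ∀ i, (colorClass (Sigma.fst : (Σ _ : Fin c, Fin n) → Fin c) i).card = n := by
    intro i
    have := card_finsetSigmaEquiv_apply (univ : Finset (Σ _ : Fin c, Fin n)) i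
    rw [colorClass, ← this]
    simp [finsetSigmaEquiv]
  refine ⟨Σ _ : Fin c, Fin n, inferInstance, Sigma.fst,
    skeletonJoin (fun v => r n v.1 ≤ (v.2 : ℕ)) d, fun i => by rw [hclass]; exact hkn i,
    fun v => ?_, representable_skeletonJoin d, collapsible_skeletonJoin d, ?_, fun i => ?_⟩
  · exact mem_skeletonJoin.2 ((Finset.card_filter_le _ _).trans (by simpa using hd))
  · have h1 : (0 : ℝ) < ∏ i, (n.choose (k i) : ℝ) :=
      Finset.prod_pos fun i _ => Nat.cast_pos.2 (Nat.choose_pos (hkn i))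
    simp only [Finset.prod_div_distrib] at hn
    rw [← Finset.sum_div, lt_div_iff₀ h1] at hn
    rw [card_colorfulSets_sigma_fin, Nat.cast_prod]
    refine hn.le.trans ?_
    exact_mod_cast sum_prod_choose_le_card_colorfulFaces k n d (r n) (hrn n)
  · have hsup : ∀ A ∈ induced (skeletonJoin (fun v : Σ _ : Fin c, Fin n => r n v.1 ≤ (v.2 : ℕ)) d)
        (colorClass Sigma.fst i), A.card ≤ r n i + d := by
      intro A hA
      obtain ⟨hAK, hAi⟩ := hA
      rw [← Finset.card_filter_add_card_filter_not (s := A)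
        (fun v : Σ _ : Fin c, Fin n => r n v.1 ≤ (v.2 : ℕ)), add_comm]
      refine add_le_add ?_ hAK
      have hmaps : ∀ v ∈ A.filter fun v => ¬ r n v.1 ≤ (v.2 : ℕ), (v.2 : ℕ) ∈ range (r n i) := by
        intro v hv
        obtain ⟨hvA, hv⟩ := mem_filter.1 hv
        have hvi : v.1 = i := by simpa [colorClass] using hAi hvA
        rw [hvi] at hv
        exact mem_range.2 (not_le.1 hv)
      refine (Finset.card_le_card_of_injOn _ hmaps ?_).trans (card_range _).le
      rintro ⟨a, x⟩ hx ⟨b, y⟩ hy hxy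
      have ha : a = i := by simpa [colorClass] using hAi (mem_filter.1 hx).1
      have hb : b = i := by simpa [colorClass] using hAi (mem_filter.1 hy).1
      subst ha
      subst hb
      simpa [Fin.val_inj] using hxy
    have hceil : d + 1 ≤ ⌈β i * n⌉₊ := by
      have := (hβn i).trans (Nat.le_ceil _)
      exact_mod_cast this
    have hr : r n i + (d + 1) = ⌈β i * n⌉₊ := Nat.sub_add_cancel hceil
    have hlt := Nat.ceil_lt_add_one (show 0 ≤ β i * n from
      mul_nonneg (hβ i).1.le (Nat.cast_nonneg n))
    rw [← hr] at hlt
    push_cast at hlt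
    rw [hclass]
    simp only [dim]
    push_cast
    refine sub_lt_sub_right (lt_of_le_of_lt (b := ((r n i + d : ℕ) : ℝ)) ?_ ?_) 1
    · refine Nat.cast_le.2 (Finset.sup_le fun A hA => hsup A (mem_filter.1 hA).2)
    · push_cast
      linarith

end Asymptotics
end ColorfulHelly

theorem theorem3p1 (c d : ℕ) (hc : 1 ≤ c) (hd : 1 ≤ d) (k : Fin c → ℕ)
    (hk : d + 1 ≤ ∑ i, k i) (β : Fin c → ℝ) (hβ : ∀ i, 0 < β i ∧ β i ≤ 1) :
    -- the theorem
    (∀ (N : Type*) [Fintype N] (color : N → Fin c) (K : ColorfulHelly.SComplex N),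
      (∀ i, k i ≤ (ColorfulHelly.colorClass color i).card) →
      ColorfulHelly.Collapsible d K →
      ColorfulHelly.alpha k d β * ((ColorfulHelly.colorfulSets color k).card : ℝ) ≤
        ((ColorfulHelly.colorfulFaces K color k).card : ℝ) →
      ∃ i, β i * ((ColorfulHelly.colorClass color i).card : ℝ) - 1 ≤
        (ColorfulHelly.dim (ColorfulHelly.induced K (ColorfulHelly.colorClass color i)) : ℝ)) ∧
    -- the value of `α` cannot be improved
    (∀ α' : ℝ, α' < ColorfulHelly.alpha k d β →
      ∃ (N : Type) (_ : Fintype N) (color : N → Fin c) (K : ColorfulHelly.SComplex N),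
        (∀ i, k i ≤ (ColorfulHelly.colorClass color i).card) ∧
        (∀ v : N, {v} ∈ K) ∧
        ColorfulHelly.Representable d K ∧
        ColorfulHelly.Collapsible d K ∧
        α' * ((ColorfulHelly.colorfulSets color k).card : ℝ) ≤
          ((ColorfulHelly.colorfulFaces K color k).card : ℝ) ∧
        ∀ i, (ColorfulHelly.dim (ColorfulHelly.induced K (ColorfulHelly.colorClass color i)) : ℝ) <
          β i * ((ColorfulHelly.colorClass color i).card : ℝ) - 1) := by
  refine ⟨fun N _ color K hkn hK hα => hK.exists_le_dim hk hβ hkn hα, fun α' hα' => ?_⟩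
  exact ColorfulHelly.exists_complex_of_lt_alpha hd k hβ hα'
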